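/- **Conventions.** Let $(X,d)$ be a geodesic metric space (not assumed proper), i.e. any two points are joined by a geodesic segment (a map $\alpha:[0,L]\to X$, $L\ge 0$, with $d(\alpha(s),\alpha(t))=|s-t|$). For $A\subseteq X$, $B\subseteq X$ put $\pi_A(x)=\{y\in A: d(x,y)\le d(x,A)+1\}$, $\pi_A(B)=\bigcup_{x\in B}\pi_A(x)$ and $N_r(A)=\{x: d(x,A)\le r\}$. A subset $Y\subseteq X$ is *contracting* if there is $C\ge 0$ such that $\mathrm{diam}(\pi_Y(\alpha))\le C$ for every geodesic segment $\alpha$ with $d(\alpha,Y)\ge C$. Let a group $G$ act on $X$ by isometries and let $o\in X$. An element $h\in G$ is *contracting* if $\langle h\rangle o$ is a contracting subset and $\mathbb Z\to X$, $n\mapsto h^no$, is a quasi-isometric embedding. Two contracting elements $g,h$ are *weakly independent* if there is a function $\mathcal R:[0,\infty)\to[0,\infty)$ with $\mathrm{diam}(N_r(\langle g\rangle o)\cap N_r(\langle h\rangle o))\le\mathcal R(r)$ for all $r\ge 0$. The action has the *contracting property* if $G$ contains two weakly independent contracting elements. (These notions do not depend on $o$.) The *stable translation length* of $g\in G$ is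 $\ell_d(g)=\lim_{n\to\infty} d(o,g^no)/n$; the limit exists and does not depend on $o$. A map $f$ between metric spaces is a *rough isometry* if there is $c\ge 0$ such that it distorts distances by at most $c$ additively and there is a map $f'$ in the opposite direction such that $f'\circ f$ and $f\circ f'$ are at bounded distance from the identities. **Theorem.** Let a group $G$ act by isometries on two geodesic metric spaces $(X_1,d_1)$ and $(X_2,d_2)$, both actions having the contracting property, and let $o_1\in X_1$, $o_2\in X_2$. Let $H\lhd G$ be a normal subgroup which has an unbounded orbit in $X_1$ or in $X_2$. Suppose that $\ell_{d_1}(g)=\ell_{d_2}(g)$ for all $g\in H$. Then $$\sup_{g,h\in G}\bigl|d_1(go_1,ho_1)-d_2(go_2,ho_2)\bigr|<\infty .$$ Consequently the orbit map $\rho:Go_1\to Go_2$, $go_1\mapsto go_2$, is well defined up to a bounded error (there is $C$ such that $d_2(go_2,ho_2)\le C$ whenever $go_1=ho_1$) and, for any choice of representatives $g$, it is a rough isometry; and $\ell_{d_1}(g)=\ell_{d_2}(g)$ for all $g\in G$. -/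

import Mathlib

open Filter Topology

/-- `α`, restricted to `[0, L]`, is a geodesic segment (of length `L ≥ 0`). -/
def IsGeodesicSegment {X : Type*} [MetricSpace X] (L : ℝ) (α : ℝ → X) : Prop :=
  0 ≤ L ∧ ∀ s ∈ Set.Icc 0 L, ∀ t ∈ Set.Icc 0 L, dist (α s) (α t) = |s - t|

/-- A geodesic metric space: any two points are joined by a geodesic segment. -/
def IsGeodesicSpace (X : Type*) [MetricSpace X] : Prop :=
  ∀ x y : X, ∃ (L : ℝ) (α : ℝ → X), IsGeodesicSegment L α ∧ α 0 = x ∧ α L = y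

/-- The coarse closest point projection of the point `x` to `A`: all points of `A` that realise the
distance from `x` to `A` up to an additive error `1`. (In a space that is not proper, an exact
closest point need not exist.) -/
def coarseProj {X : Type*} [MetricSpace X] (A : Set X) (x : X) : Set X :=
  {y | y ∈ A ∧ dist x y ≤ Metric.infDist x A + 1}

/-- The coarse closest point projection of a set `B` to `A`. -/
def coarseProjSet {X : Type*} [MetricSpace X] (A B : Set X) : Set X :=
  ⋃ x ∈ B, coarseProj A x

/-- `Y` is `C`-contracting: every geodesic segment at distance at least `C` from `Y` has a
projection to `Y` of diameter at most `C`. -/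
def IsContractingWith {X : Type*} [MetricSpace X] (C : ℝ) (Y : Set X) : Prop :=
  ∀ (L : ℝ) (α : ℝ → X), IsGeodesicSegment L α →
    (∀ x ∈ α '' Set.Icc 0 L, ∀ y ∈ Y, C ≤ dist x y) →
    ∀ p ∈ coarseProjSet Y (α '' Set.Icc 0 L), ∀ q ∈ coarseProjSet Y (α '' Set.Icc 0 L),
      dist p q ≤ C

/-- A contracting subset. -/
def IsContractingSubset {X : Type*} [MetricSpace X] (Y : Set X) : Prop :=
  ∃ C : ℝ, 0 ≤ C ∧ IsContractingWith C Y

/-- `Y` and `Z` have `R`-bounded intersection for some gauge `R : [0, ∞) → [0, ∞)`: for all `r ≥ 0`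
the closed `r`-neighbourhoods of `Y` and `Z` intersect in a set of diameter at most `R r`. -/
def HasBoundedIntersection {X : Type*} [MetricSpace X] (Y Z : Set X) : Prop :=
  ∃ R : NNReal → NNReal, ∀ r : NNReal,
    ∀ p ∈ Metric.cthickening (r : ℝ) Y ∩ Metric.cthickening (r : ℝ) Z,
    ∀ q ∈ Metric.cthickening (r : ℝ) Y ∩ Metric.cthickening (r : ℝ) Z, dist p q ≤ R r

/-- `(lam, c)`-quasi-isometric embeddings. -/
def IsQuasiIsometricEmbedding {X Y : Type*} [MetricSpace X] [MetricSpace Y] (lam c : ℝ)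
    (f : X → Y) : Prop :=
  1 ≤ lam ∧ 0 ≤ c ∧ ∀ x x' : X,
    (1 / lam) * dist x x' - c ≤ dist (f x) (f x') ∧ dist (f x) (f x') ≤ lam * dist x x' + c

/-- `(lam, c)`-quasi-isometries: quasi-isometric embeddings that have a quasi-inverse. -/
def IsQuasiIsometry {X Y : Type*} [MetricSpace X] [MetricSpace Y] (lam c : ℝ)
    (f : X → Y) : Prop :=
  IsQuasiIsometricEmbedding lam c f ∧
    ∃ (g : Y → X) (K : ℝ), (∀ x : X, dist x (g (f x)) ≤ K) ∧ ∀ y : Y, dist y (f (g y)) ≤ K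

/-- Rough isometries. -/
def IsRoughIsometry {X Y : Type*} [MetricSpace X] [MetricSpace Y] (f : X → Y) : Prop :=
  ∃ c : ℝ, 0 ≤ c ∧ IsQuasiIsometry 1 c f

/-- The orbit `⟨h⟩ · o` of the cyclic subgroup generated by `h`. -/
def cyclicOrbit {G X : Type*} [Group G] [MulAction G X] (o : X) (h : G) : Set X :=
  Set.range fun n : ℤ => h ^ n • o

/-- `h` is a contracting element, with respect to the basepoint `o`. -/
def IsContractingElement {G X : Type*} [Group G] [MetricSpace X] [MulAction G X] (o : X)
    (h : G) : Prop :=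
  IsContractingSubset (cyclicOrbit o h) ∧
    ∃ lam c : ℝ, IsQuasiIsometricEmbedding lam c fun n : ℤ => h ^ n • o

/-- The action of `G` on `X` has contracting property: there are two contracting elements that are
weakly independent, that is, whose cyclic orbits have bounded intersection. For isometric actions on
geodesic spaces this does not depend on the basepoint `o`. -/
def HasContractingProperty (G X : Type*) [Group G] [MetricSpace X] [MulAction G X] : Prop :=
  ∃ (o : X) (g h : G), IsContractingElement o g ∧ IsContractingElement o h ∧
    HasBoundedIntersection (cyclicOrbit o g) (cyclicOrbit o h)

/-- The subgroup `H` has an unbounded orbit in `X`. -/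
def HasUnboundedOrbit {G : Type*} (X : Type*) [Group G] [MetricSpace X] [MulAction G X]
    (H : Subgroup G) : Prop :=
  ∃ x : X, ¬ Bornology.IsBounded (MulAction.orbit H x)

/-- The stable translation length of `g`, computed at the basepoint `o`: the limit of
`d(o, g ^ n o) / n`. The limit exists, see `tendsto_stableLength`. -/
noncomputable def stableLength {G X : Type*} [Group G] [MetricSpace X] [MulAction G X] (o : X)
    (g : G) : ℝ :=
  limUnder atTop fun n : ℕ => dist o (g ^ n • o) / n

/-- The limit that defines the stable translation length exists. -/
theorem tendsto_stableLength {G X : Type*} [Group G] [MetricSpace X] [MulAction G X]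
    [IsIsometricSMul G X] (o : X) (g : G) :
    Tendsto (fun n : ℕ => dist o (g ^ n • o) / n) atTop (𝓝 (stableLength o g)) := by
  have hs : Subadditive fun n : ℕ => dist o (g ^ n • o) := by
    intro m n
    have h1 : dist (g ^ m • o) (g ^ (m + n) • o) = dist o (g ^ n • o) := by
      rw [pow_add, mul_smul, dist_smul]
    have h2 := dist_triangle o (g ^ m • o) (g ^ (m + n) • o)
    rw [h1] at h2
    exact h2
  have hb : BddBelow (Set.range fun n : ℕ => dist o (g ^ n • o) / n) := by
    refine ⟨0, ?_⟩
    rintro _ ⟨n, rfl⟩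
    positivity
  exact tendsto_nhds_limUnder ⟨_, hs.tendsto_lim hb⟩

/-- `ρ` is an orbit map `G o₁ → G o₂`, that is, a map of the form `g o₁ ↦ g o₂`, where for each point
of `G o₁` one choice of `g` is made. -/
def IsOrbitMap {G X₁ X₂ : Type*} [Group G] [MulAction G X₁] [MulAction G X₂] (o₁ : X₁) (o₂ : X₂)
    (ρ : MulAction.orbit G o₁ → MulAction.orbit G o₂) : Prop :=
  ∀ x : MulAction.orbit G o₁, ∃ g : G, (x : X₁) = g • o₁ ∧ (ρ x : X₂) = g • o₂

/-! Write `|g|` for the displacement of the basepoint. Lengths are compared only on `H`, so the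
displacement of an arbitrary element has to be read off from an element of `H`. For `a ∈ H`,
normality puts `a * t * a * t⁻¹ = a * (t * a * t⁻¹)` in `H` for every `t`. In any isometric action
its stable length is at most `2|t| + 2|a|`.

Contraction gives the converse up to a constant. If `t` is a bridge and `a` is a bridge conjugated
by a high power of a contracting element, the path traced by the powers of this word hardly
backtracks, so its stable length is at least `2|t|` minus a constant
(`IsContractingWith.le_stableLength`, by iterating `IsContractingWith.step`). Weak independence
turns any long `g` into a bridge `t` using finitely many multipliers (`exists_projectsNear_of_ne`),
and the unbounded orbit supplies a suitable `a ∈ H` (`exists_mem_normal_le_stableLength`).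

The lower bound in one action and the upper bound in the other give a one-sided comparison of
displacements (`exists_dist_le_dist_add`). It carries unboundedness of the `H`-orbit across, so it
holds both ways. -/

namespace IsGeodesicSegment

variable {X : Type*} [MetricSpace X] {L : ℝ} {α : ℝ → X}

theorem shift (hα : IsGeodesicSegment L α) {a b : ℝ} (ha : 0 ≤ a) (hab : a ≤ b) (hb : b ≤ L) :
    IsGeodesicSegment (b - a) fun t => α (a + t) := by
  refine ⟨by linarith, fun s hs t ht => ?_⟩
  rw [hα.2 _ ⟨by linarith [hs.1], by linarith [hs.2]⟩ _ ⟨by linarith [ht.1], by linarith [ht.2]⟩]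
  congr 1
  ring

theorem reverse (hα : IsGeodesicSegment L α) : IsGeodesicSegment L fun t => α (L - t) := by
  refine ⟨hα.1, fun s hs t ht => ?_⟩
  rw [hα.2 _ ⟨by linarith [hs.2], by linarith [hs.1]⟩ _ ⟨by linarith [ht.2], by linarith [ht.1]⟩,
    abs_sub_comm]
  congr 1
  ring

theorem dist_of_le (hα : IsGeodesicSegment L α) {a b : ℝ} (ha : 0 ≤ a) (hab : a ≤ b)
    (hb : b ≤ L) : dist (α a) (α b) = b - a := by
  rw [hα.2 _ ⟨ha, hab.trans hb⟩ _ ⟨ha.trans hab, hb⟩, abs_sub_comm, abs_of_nonneg (by linarith)]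

end IsGeodesicSegment

/-! ### Coarse projections to contracting sets. -/

section Projection

variable {X : Type*} [MetricSpace X] {Y : Set X} {C : ℝ}

theorem coarseProj_nonempty (hY : Y.Nonempty) (x : X) : (coarseProj Y x).Nonempty := by
  obtain ⟨y, hy, h⟩ := (Metric.infDist_lt_iff hY (x := x) (r := Metric.infDist x Y + 1)).1
    (by linarith)
  exact ⟨y, hy, h.le⟩

theorem IsContractingWith.mono {C' : ℝ} (h : IsContractingWith C Y) (hC : C ≤ C') :
    IsContractingWith C' Y := fun L α hα hd p hp q hq =>
  (h L α hα (fun x hx y hy => hC.trans (hd x hx y hy)) p hp q hq).trans hC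

/-- A geodesic that ends near a contracting set passes near the projection of its initial point. -/
theorem IsContractingWith.exists_near_initial (h : IsContractingWith C Y) (hY : Y.Nonempty)
    {L : ℝ} {α : ℝ → X} (hα : IsGeodesicSegment L α) (hL : Metric.infDist (α L) Y ≤ C) {p : X}
    (hp : p ∈ coarseProj Y (α 0)) : ∃ z ∈ Set.Icc 0 L, dist (α z) p ≤ 2 * C + 2 := by
  have hC0 : 0 ≤ C := Metric.infDist_nonneg.trans hL
  set T : Set ℝ := {s | s ∈ Set.Icc 0 L ∧ Metric.infDist (α s) Y ≤ C} with hT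
  have hne : T.Nonempty := ⟨L, ⟨hα.1, le_rfl⟩, hL⟩
  have hbdd : BddBelow T := ⟨0, fun s hs => hs.1.1⟩
  -- With `s` less than `1` beyond the infimum, `[0, s - 1]` avoids `T` and contraction applies
  -- there. Stepping back costs `1` and the coarse projection another `1`, hence the `+ 2`.
  obtain ⟨s, hs, hlt⟩ := exists_lt_of_csInf_lt hne (show sInf T < sInf T + 1 by linarith)
  rcases lt_or_ge s 1 with h1 | h1
  · refine ⟨0, ⟨le_rfl, hα.1⟩, ?_⟩
    have h2 := Metric.infDist_le_infDist_add_dist (s := Y) (x := α 0) (y := α s)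
    rw [hα.dist_of_le le_rfl hs.1.1 hs.1.2] at h2
    linarith [hp.2, hs.2]
  · have hr : s - 1 ∈ Set.Icc 0 L := ⟨by linarith, by linarith [hs.1.2]⟩
    obtain ⟨q, hq⟩ := coarseProj_nonempty hY (α (s - 1))
    refine ⟨s - 1, hr, ?_⟩
    have hseg : IsGeodesicSegment (s - 1) α :=
      ⟨hr.1, fun a ha b hb => hα.2 a ⟨ha.1, ha.2.trans hr.2⟩ b ⟨hb.1, hb.2.trans hr.2⟩⟩
    have hpq : dist p q ≤ C := by
      refine h _ α hseg ?_ p ?_ q ?_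
      · rintro _ ⟨t, ht, rfl⟩ y hy
        by_contra! hlt'
        have : t ∈ T := ⟨⟨ht.1, ht.2.trans hr.2⟩, (Metric.infDist_le_dist_of_mem hy).trans hlt'.le⟩
        linarith [csInf_le hbdd this, ht.2]
      · exact Set.mem_biUnion (Set.mem_image_of_mem α ⟨le_rfl, hr.1⟩) hp
      · exact Set.mem_biUnion (Set.mem_image_of_mem α ⟨hr.1, le_rfl⟩) hq
    have h2 := Metric.infDist_le_infDist_add_dist (s := Y) (x := α (s - 1)) (y := α s)
    rw [hα.dist_of_le hr.1 (by linarith) hs.1.2] at h2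
    have h3 := dist_triangle_right (α (s - 1)) p q
    linarith [hq.2, hs.2]

theorem IsContractingWith.exists_near_left (h : IsContractingWith C Y) (hY : Y.Nonempty)
    {L : ℝ} {α : ℝ → X} (hα : IsGeodesicSegment L α) {a b : ℝ} (ha : 0 ≤ a) (hab : a ≤ b)
    (hb : b ≤ L) (hd : Metric.infDist (α b) Y ≤ C) {p : X} (hp : p ∈ coarseProj Y (α a)) :
    ∃ z ∈ Set.Icc a b, dist (α z) p ≤ 2 * C + 2 := by
  obtain ⟨z, hz, hzp⟩ := h.exists_near_initial hY (hα.shift ha hab hb) (p := p)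
    (by simpa using hd) (by simpa using hp)
  exact ⟨a + z, ⟨by linarith [hz.1], by linarith [hz.2]⟩, hzp⟩

theorem IsContractingWith.exists_near_right (h : IsContractingWith C Y) (hY : Y.Nonempty)
    {L : ℝ} {α : ℝ → X} (hα : IsGeodesicSegment L α) {a b : ℝ} (ha : 0 ≤ a) (hab : a ≤ b)
    (hb : b ≤ L) (hd : Metric.infDist (α a) Y ≤ C) {p : X} (hp : p ∈ coarseProj Y (α b)) :
    ∃ z ∈ Set.Icc a b, dist (α z) p ≤ 2 * C + 2 := by
  obtain ⟨z, hz, hzp⟩ := h.exists_near_left hY hα.reverse (a := L - b) (b := L - a) (p := p)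
    (by linarith) (by linarith) (by linarith) (by simpa using hd) (by simpa using hp)
  exact ⟨L - z, ⟨by linarith [hz.2], by linarith [hz.1]⟩, hzp⟩

/-- Contracting sets are quasiconvex. -/
theorem IsContractingWith.infDist_le (h : IsContractingWith C Y) (hY : Y.Nonempty)
    {L : ℝ} {α : ℝ → X} (hα : IsGeodesicSegment L α) {a b c : ℝ} (ha : 0 ≤ a) (hab : a ≤ b)
    (hbc : b ≤ c) (hc : c ≤ L) (hda : Metric.infDist (α a) Y ≤ C)
    (hdc : Metric.infDist (α c) Y ≤ C) : Metric.infDist (α b) Y ≤ 6 * C + 6 := by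
  -- Both halves of the geodesic pass within `2C + 2` of `p`, at times `z ≤ b ≤ y`; so `y - z ≤ 4C +
  -- 4`, and `α b` is within `(4C + 4) + (2C + 2)` of `p`.
  obtain ⟨p, hp⟩ := coarseProj_nonempty hY (α b)
  obtain ⟨z, hz, hzp⟩ := h.exists_near_right hY hα ha hab (hbc.trans hc) hda hp
  obtain ⟨y, hy, hyp⟩ := h.exists_near_left hY hα (ha.trans hab) hbc hc hdc hp
  have h1 := hα.dist_of_le (ha.trans hz.1) (hz.2.trans hy.1) (hy.2.trans hc)
  have h2 := hα.dist_of_le (ha.trans hab) hy.1 (hy.2.trans hc)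
  have h3 := dist_triangle_right (α z) (α y) p
  have h4 := dist_triangle (α b) (α y) p
  have h5 := Metric.infDist_le_dist_of_mem (x := α b) hp.1
  linarith [hz.2]

/-- A geodesic that stays far from `Y` has a small projection, so this one must come `C`-close to
`Y`. Cutting it there reduces to the one-sided estimates. -/
theorem IsContractingWith.exists_near_of_lt_dist (h : IsContractingWith C Y) (hY : Y.Nonempty)
    {L : ℝ} {α : ℝ → X} (hα : IsGeodesicSegment L α) {p q : X} (hp : p ∈ coarseProj Y (α 0))
    (hq : q ∈ coarseProj Y (α L)) (hpq : C < dist p q) :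
    (∃ z ∈ Set.Icc 0 L, dist (α z) p ≤ 2 * C + 2) ∧
      ∃ z ∈ Set.Icc 0 L, dist (α z) q ≤ 2 * C + 2 := by
  obtain ⟨s, hs, hd⟩ : ∃ s ∈ Set.Icc 0 L, Metric.infDist (α s) Y ≤ C := by
    by_contra! hcon
    refine hpq.not_ge (h L α hα ?_ p ?_ q ?_)
    · rintro _ ⟨t, ht, rfl⟩ y hy
      exact (hcon t ht).le.trans (Metric.infDist_le_dist_of_mem hy)
    · exact Set.mem_biUnion (Set.mem_image_of_mem α ⟨le_rfl, hα.1⟩) hp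
    · exact Set.mem_biUnion (Set.mem_image_of_mem α ⟨hα.1, le_rfl⟩) hq
  obtain ⟨z, hz, hzp⟩ := h.exists_near_left hY hα le_rfl hs.1 hs.2 hd hp
  obtain ⟨y, hy, hyq⟩ := h.exists_near_right hY hα hs.1 hs.2 le_rfl hd hq
  exact ⟨⟨z, ⟨hz.1, hz.2.trans hs.2⟩, hzp⟩, ⟨y, ⟨hs.1.trans hy.1, hy.2⟩, hyq⟩⟩

theorem IsGeodesicSegment.dist_add_dist_le {L r : ℝ} {α : ℝ → X} (hα : IsGeodesicSegment L α)
    {z : ℝ} (hz : z ∈ Set.Icc 0 L) {p : X} (hp : dist (α z) p ≤ r) :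
    dist (α 0) p + dist p (α L) ≤ dist (α 0) (α L) + 2 * r := by
  have h1 := hα.dist_of_le le_rfl hz.1 hz.2
  have h2 := hα.dist_of_le hz.1 hz.2 le_rfl
  have h3 := hα.dist_of_le le_rfl hα.1 le_rfl
  have h4 := dist_triangle (α 0) (α z) p
  have h5 := dist_triangle_left p (α L) (α z)
  linarith

/-- If the projections of `x` and `y` are far apart, geodesics from `x` to `y` pass near the
projection of `y`. -/
theorem IsContractingWith.dist_add_dist_le_of_lt_dist (h : IsContractingWith C Y)
    (hX : IsGeodesicSpace X) (hY : Y.Nonempty) {x y p q : X} (hp : p ∈ coarseProj Y x)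
    (hq : q ∈ coarseProj Y y) (hpq : C < dist p q) :
    dist x q + dist q y ≤ dist x y + (4 * C + 4) := by
  obtain ⟨L, α, hα, rfl, rfl⟩ := hX x y
  obtain ⟨-, z, hz, hzq⟩ := h.exists_near_of_lt_dist hY hα hp hq hpq
  linarith [hα.dist_add_dist_le hz hzq]

theorem IsContractingWith.dist_add_dist_le_of_mem (h : IsContractingWith C Y) (hC : 0 ≤ C)
    (hX : IsGeodesicSpace X) {x y p : X} (hp : p ∈ coarseProj Y x) (hy : y ∈ Y) :
    dist x p + dist p y ≤ dist x y + (4 * C + 4) := by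
  obtain ⟨L, α, hα, rfl, rfl⟩ := hX x y
  obtain ⟨z, hz, hzp⟩ := h.exists_near_initial ⟨_, hy⟩ hα
    (by rwa [Metric.infDist_zero_of_mem hy]) hp
  linarith [hα.dist_add_dist_le hz hzp]

/-- The coarse projection to a contracting set is coarsely Lipschitz. -/
theorem IsContractingWith.dist_proj_le (h : IsContractingWith C Y) (hC : 0 ≤ C)
    (hX : IsGeodesicSpace X) (hY : Y.Nonempty) {x y p q : X} (hp : p ∈ coarseProj Y x)
    (hq : q ∈ coarseProj Y y) : dist p q ≤ dist x y + (4 * C + 4) := by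
  rcases le_or_gt (dist p q) C with hpq | hpq
  · linarith [dist_nonneg (x := x) (y := y)]
  · obtain ⟨L, α, hα, rfl, rfl⟩ := hX x y
    obtain ⟨⟨z, hz, hzp⟩, w, hw, hwq⟩ := h.exists_near_of_lt_dist hY hα hp hq hpq
    have h1 := hα.2 z hz w hw
    have h2 : |z - w| ≤ L := abs_le.2 ⟨by linarith [hz.1, hw.2], by linarith [hz.2, hw.1]⟩
    have h3 := hα.dist_of_le le_rfl hα.1 le_rfl
    have h4 := dist_triangle4 p (α z) (α w) q
    rw [dist_comm p (α z)] at h4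
    linarith

/-- `x` projects to `Y` within `D` of `o`. -/
def ProjectsNear (Y : Set X) (o : X) (D : ℝ) (x : X) : Prop :=
  ∀ p ∈ coarseProj Y x, dist p o ≤ D

/-- The situation in `projectsNear_or` where the geodesic from a point to `o` meets `Y'` first. -/
theorem IsContractingWith.dist_le_of_gauge {Y' : Set X} {o : X} (h' : IsContractingWith C Y')
    (hC : 0 ≤ C) (hoY : o ∈ Y) (hoY' : o ∈ Y') {R : NNReal → NNReal}
    (hR : ∀ r : NNReal, ∀ p ∈ Metric.cthickening (r : ℝ) Y' ∩ Metric.cthickening (r : ℝ) Y,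
      ∀ q ∈ Metric.cthickening (r : ℝ) Y' ∩ Metric.cthickening (r : ℝ) Y, dist p q ≤ R r)
    {L : ℝ} {α : ℝ → X} (hα : IsGeodesicSegment L α) (hL : α L = o) {a b : ℝ} (ha : 0 ≤ a)
    (hab : a ≤ b) (hb : b ≤ L) (hda : Metric.infDist (α a) Y' ≤ 2 * C + 2) {q : X} (hq : q ∈ Y)
    (hbq : dist (α b) q ≤ 2 * C + 2) :
    dist q o ≤ R (Real.toNNReal (12 * C + 18)) + (2 * C + 2) := by
  -- `12C + 18 = 6(2C + 2) + 6` is the quasiconvexity bound for the enlarged contraction constant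
  -- `2C + 2`.
  have hr : ((Real.toNNReal (12 * C + 18) : NNReal) : ℝ) = 12 * C + 18 :=
    Real.coe_toNNReal _ (by linarith)
  have hC' : C ≤ 2 * C + 2 := by linarith
  have h1 := (h'.mono hC').infDist_le ⟨o, hoY'⟩ hα ha hab hb le_rfl hda
    (by rw [hL, Metric.infDist_zero_of_mem hoY']; linarith)
  have hmem : α b ∈ Metric.cthickening (12 * C + 18) Y' := by
    obtain ⟨y, hy⟩ := Metric.infDist_lt_iff ⟨o, hoY'⟩ |>.1
      (show Metric.infDist (α b) Y' < 12 * C + 18 + 1 by linarith)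
    rw [Metric.cthickening, Set.mem_ofPred_eq]
    rw [Metric.infDist] at h1
    exact ENNReal.le_ofReal_iff_toReal_le (Metric.infEDist_ne_top ⟨o, hoY'⟩) (by linarith)
      |>.2 (by linarith)
  have hmem' : α b ∈ Metric.cthickening (12 * C + 18) Y :=
    Metric.mem_cthickening_of_dist_le _ q _ _ hq (by linarith)
  have h2 := hR (Real.toNNReal (12 * C + 18)) (α b) (by rw [hr]; exact ⟨hmem, hmem'⟩) o
    (by rw [hr]; exact ⟨Metric.self_subset_cthickening _ hoY',
      Metric.self_subset_cthickening _ hoY⟩)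
  have h3 := dist_triangle_left q o (α b)
  linarith

/-- For contracting sets with bounded intersection that meet at `o`, every point projects near `o`
to one of them. -/
theorem exists_projectsNear_or {Y' : Set X} {o : X} (hX : IsGeodesicSpace X)
    (hY : IsContractingSubset Y) (hY' : IsContractingSubset Y') (hoY : o ∈ Y) (hoY' : o ∈ Y')
    (hb : HasBoundedIntersection Y' Y) :
    ∃ D : ℝ, 0 ≤ D ∧ ∀ x, ProjectsNear Y' o D x ∨ ProjectsNear Y o D x := by
  obtain ⟨C₁, hC₁, h₁⟩ := hY
  obtain ⟨C₂, hC₂, h₂⟩ := hY'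
  obtain ⟨R, hR⟩ := hb
  obtain ⟨C, hC, h, h'⟩ : ∃ C, 0 ≤ C ∧ IsContractingWith C Y ∧ IsContractingWith C Y' :=
    ⟨max C₁ C₂, hC₁.trans (le_max_left _ _), h₁.mono (le_max_left _ _), h₂.mono (le_max_right _ _)⟩
  refine ⟨R (Real.toNNReal (12 * C + 18)) + (2 * C + 2), by positivity, fun x => ?_⟩
  by_contra! hcon
  simp only [ProjectsNear, not_forall, not_le] at hcon
  obtain ⟨⟨p, hp, hpo⟩, q, hq, hqo⟩ := hcon
  obtain ⟨L, α, hα, rfl, hL⟩ := hX x o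
  obtain ⟨a, ha, hap⟩ := h'.exists_near_initial ⟨o, hoY'⟩ hα
    (by rwa [hL, Metric.infDist_zero_of_mem hoY']) hp
  obtain ⟨b, hb, hbq⟩ := h.exists_near_initial ⟨o, hoY⟩ hα
    (by rwa [hL, Metric.infDist_zero_of_mem hoY]) hq
  -- Whichever set is met first, quasiconvexity keeps the geodesic near it until `o`. At the later
  -- time it is near both sets, and the gauge bounds its distance to `o`.
  rcases le_total a b with hab | hab
  · exact hqo.not_ge (h'.dist_le_of_gauge hC hoY hoY' hR hα hL ha.1 hab hb.2
      ((Metric.infDist_le_dist_of_mem hp.1).trans hap) hq.1 hbq)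
  · exact hpo.not_ge (h.dist_le_of_gauge hC hoY' hoY
      (fun r x hx y hy => hR r x hx.symm y hy.symm) hα hL hb.1 hab ha.2
      ((Metric.infDist_le_dist_of_mem hq.1).trans hbq) hp.1 hap)

end Projection

/-! ### Translates of cyclic orbits. -/

section Action

open Pointwise

variable {G X : Type*} [Group G] [MulAction G X]

theorem mem_cyclicOrbit (o : X) (f : G) : o ∈ cyclicOrbit o f := ⟨0, by simp⟩

theorem zpow_smul_cyclicOrbit (o : X) (f : G) (n : ℤ) :
    f ^ n • cyclicOrbit o f = cyclicOrbit o f := by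
  ext y
  rw [Set.mem_smul_set_iff_inv_smul_mem]
  constructor
  · rintro ⟨m, hm⟩
    refine ⟨n + m, ?_⟩
    simp only at hm ⊢
    rw [zpow_add, mul_smul, hm, smul_inv_smul]
  · rintro ⟨m, rfl⟩
    refine ⟨-n + m, ?_⟩
    simp only
    rw [zpow_add, mul_smul, zpow_neg]

variable [MetricSpace X]

theorem exists_le_dist_zpow {o : X} {f : G} {lam c : ℝ}
    (h : IsQuasiIsometricEmbedding lam c fun n : ℤ => f ^ n • o) (K : ℝ) :
    ∃ N : ℕ, 0 < N ∧ ∀ m n : ℤ, (N : ℤ) ≤ |m - n| → K ≤ dist (f ^ m • o) (f ^ n • o) := by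
  obtain ⟨hlam, -, h⟩ := h
  obtain ⟨N, hN⟩ := exists_nat_gt (lam * (K + c))
  refine ⟨N + 1, by positivity, fun m n hmn => ?_⟩
  have h1 := (h m n).1
  have h2 : ((N + 1 : ℕ) : ℝ) ≤ dist m n := by
    rw [Int.dist_eq]
    exact_mod_cast hmn
  have h3 : K + c ≤ 1 / lam * dist m n := by
    rw [one_div, ← div_eq_inv_mul, le_div_iff₀ (by linarith)]
    push_cast at h2
    linarith
  linarith

/-- A bridge: an element that moves `o` by more than `T`, both whose endpoints project near `o`. -/
def IsBridge (Y : Set X) (o : X) (D T : ℝ) (t : G) : Prop :=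
  ProjectsNear Y o D (t • o) ∧ ProjectsNear Y o D (t⁻¹ • o) ∧ T < dist o (t • o)

variable [IsIsometricSMul G X]

theorem smul_mem_coarseProj {Y : Set X} {u : G} (hu : u • Y = Y) {x p : X}
    (hp : p ∈ coarseProj Y x) : u • p ∈ coarseProj Y (u • x) := by
  refine ⟨hu ▸ Set.smul_mem_smul_set hp.1, ?_⟩
  have : Metric.infDist (u • x) Y = Metric.infDist x Y := by
    conv_lhs => rw [← hu]
    exact Metric.infDist_image (isometry_smul X u)
  rw [dist_smul, this]
  exact hp.2

theorem dist_smul_inv_self (o : X) (t : G) : dist o (t⁻¹ • o) = dist o (t • o) := by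
  rw [← dist_smul t, smul_inv_smul, dist_comm]

theorem dist_self_mul_smul_le (o : X) (g h : G) :
    dist o ((g * h) • o) ≤ dist o (g • o) + dist o (h • o) := by
  rw [mul_smul, ← dist_smul g o (h • o)]
  exact dist_triangle _ _ _

/-! ### Stable translation lengths. -/

theorem stableLength_nonneg (o : X) (g : G) : 0 ≤ stableLength o g :=
  ge_of_tendsto' (tendsto_stableLength o g) fun n => by positivity

theorem dist_pow_smul_le (o : X) (g : G) (n : ℕ) :
    dist o (g ^ n • o) ≤ n * dist o (g • o) := by
  induction n with
  | zero => simp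
  | succ n ih =>
    rw [pow_succ]
    push_cast
    linarith [dist_self_mul_smul_le o (g ^ n) g]

theorem stableLength_le (o : X) (g : G) : stableLength o g ≤ dist o (g • o) := by
  refine le_of_tendsto (tendsto_stableLength o g) ?_
  filter_upwards [eventually_gt_atTop 0] with n hn
  rw [div_le_iff₀ (by positivity), mul_comm]
  exact dist_pow_smul_le o g n

theorem le_stableLength {o : X} {g : G} {c : ℝ}
    (h : ∀ n : ℕ, n * c ≤ dist o (g ^ n • o)) : c ≤ stableLength o g := by
  refine ge_of_tendsto (tendsto_stableLength o g) ?_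
  filter_upwards [eventually_gt_atTop 0] with n hn
  rw [le_div_iff₀ (by positivity), mul_comm]
  exact h n

/-- Orbit maps at bounded additive error give the same stable translation lengths. -/
theorem stableLength_eq_of_abs_sub_le {X' : Type*} [MetricSpace X'] [MulAction G X']
    [IsIsometricSMul G X'] {o : X} {o' : X'} {C : ℝ}
    (h : ∀ g : G, |dist o (g • o) - dist o' (g • o')| ≤ C) (g : G) :
    stableLength o g = stableLength o' g := by
  have h1 := (tendsto_stableLength o g).sub (tendsto_stableLength o' g)
  have h2 : Tendsto (fun n : ℕ => dist o (g ^ n • o) / n - dist o' (g ^ n • o') / n) atTop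
      (𝓝 0) := by
    refine squeeze_zero_norm (fun n => ?_) (tendsto_const_div_atTop_nhds_zero_nat C)
    rw [← sub_div, norm_div, Real.norm_eq_abs, Real.norm_natCast]
    exact div_le_div_of_nonneg_right (h _) (by positivity)
  exact sub_eq_zero.1 (tendsto_nhds_unique h1 h2)

theorem abs_dist_sub_dist_le (o o' : X) (g : G) :
    |dist o (g • o) - dist o' (g • o')| ≤ 2 * dist o o' := by
  have h1 := dist_triangle4 o o' (g • o') (g • o)
  have h2 := dist_triangle4 o' o (g • o) (g • o')
  rw [dist_smul] at h1 h2
  rw [dist_comm o' o] at h1 h2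
  rw [abs_le]
  constructor <;> linarith

theorem stableLength_basepoint (o o' : X) (g : G) : stableLength o g = stableLength o' g :=
  stableLength_eq_of_abs_sub_le (abs_dist_sub_dist_le o o') g

/-! ### Bridges and paths without backtracking. -/

theorem IsBridge.inv {Y : Set X} {o : X} {D T : ℝ} {t : G} (ht : IsBridge Y o D T t) :
    IsBridge Y o D T t⁻¹ :=
  ⟨ht.2.1, by rw [inv_inv]; exact ht.1, by rw [dist_smul_inv_self]; exact ht.2.2⟩

/-- Prolonging a path by a long piece `u` along the contracting set and a bridge `t`. -/
theorem IsContractingWith.step {Y : Set X} {C D : ℝ} {o : X} (h : IsContractingWith C Y)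
    (hC : 0 ≤ C) (hX : IsGeodesicSpace X) (ho : o ∈ Y) {t u : G} (hu : u • Y = Y)
    (hK : 2 * (D + C) + (4 * C + 4) ≤ dist o (u • o))
    (ht : IsBridge Y o D (2 * D + (4 * C + 4)) t) {x : X} (hx : ProjectsNear Y o (D + C) x) :
    dist x o + dist o (t • o) - (2 * D + (4 * C + 4)) ≤ dist x ((u * t) • o) ∧
      ProjectsNear Y o (D + C) ((u * t)⁻¹ • x) := by
  have hY : Y.Nonempty := ⟨o, ho⟩
  obtain ⟨ht₁, ht₂, hT⟩ := ht
  have huo : u • o ∈ Y := hu ▸ Set.smul_mem_smul_set ho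
  obtain ⟨p, hp⟩ := coarseProj_nonempty hY x
  obtain ⟨q₀, hq₀⟩ := coarseProj_nonempty hY (t • o)
  have hpo := hx p hp
  have hqo := ht₁ q₀ hq₀
  have hq := smul_mem_coarseProj hu hq₀
  rw [← dist_smul u] at hqo
  have hut : dist (u • o) (u • t • o) = dist o (t • o) := dist_smul _ _ _
  have hgain : dist x (u • o) + dist o (t • o) - (2 * D + (4 * C + 4)) ≤ dist x (u • t • o) := by
    have h1 := dist_triangle4_left p (u • q₀) o (u • o)
    have h2 := dist_triangle4 o p (u • q₀) (u • o)
    rw [dist_comm o p] at h2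
    have h3 := h.dist_add_dist_le_of_lt_dist hX hY hp hq (by linarith)
    have h4 := dist_triangle x (u • q₀) (u • o)
    have h5 := dist_triangle_left (u • o) (u • t • o) (u • q₀)
    linarith
  -- The lower bound on `dist o (u • o)` absorbs exactly the errors here: `D + C` twice and `4C +
  -- 4`.
  have hlong : dist x o ≤ dist x (u • o) := by
    have h1 := h.dist_add_dist_le_of_mem hC hX hp huo
    have h2 := dist_triangle x p o
    have h3 := dist_triangle_left o (u • o) p
    linarith
  refine ⟨by rw [mul_smul]; linarith, fun p' hp' => ?_⟩
  -- Seen from `(u * t) • o`, a far projection of `x` would force the geodesic from `x` to `u • o`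
  -- to pass near `(u * t) • o`. With `hgain` this contradicts the length of `t`. The bound `D + C`
  -- is thus restored and does not grow under iteration.
  by_contra! hfar
  obtain ⟨q', hq'⟩ := coarseProj_nonempty hY (t⁻¹ • o)
  have hq'o := ht₂ q' hq'
  have h1 := dist_triangle p' q' o
  have h2 := h.dist_add_dist_le_of_lt_dist hX hY hp' hq' (by linarith)
  have h3 : dist ((u * t)⁻¹ • x) (t⁻¹ • o) = dist x (u • o) := by
    rw [← dist_smul (u * t), smul_inv_smul, mul_smul, smul_inv_smul]
  have h4 : dist ((u * t)⁻¹ • x) o = dist x (u • t • o) := by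
    rw [← dist_smul (u * t), smul_inv_smul, mul_smul]
  have h5 := dist_triangle ((u * t)⁻¹ • x) q' o
  have h6 := dist_triangle_left o (t⁻¹ • o) q'
  rw [dist_smul_inv_self] at h6
  linarith

/-- Lower bound for the stable translation length of `a t a t⁻¹`, where `t` is a bridge and `a` is a
bridge conjugated by a high power of a contracting element. -/
theorem IsContractingWith.le_stableLength {C D : ℝ} {o : X} {f : G}
    (h : IsContractingWith C (cyclicOrbit o f)) (hC : 0 ≤ C) (hD : 1 ≤ D)
    (hX : IsGeodesicSpace X) {k : ℤ} (hk : 2 * (D + C) + (4 * C + 4) ≤ dist o (f ^ k • o))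
    {s t : G} (hs : IsBridge (cyclicOrbit o f) o D (2 * D + (4 * C + 4)) s)
    (ht : IsBridge (cyclicOrbit o f) o D (2 * D + (4 * C + 4)) t) :
    2 * dist o (t • o) - 2 * (2 * D + (4 * C + 4)) ≤
      stableLength o (f ^ (-k) * s * f ^ k * t * (f ^ (-k) * s * f ^ k) * t⁻¹) := by
  set w := f ^ (-k) * s * f ^ k * t * (f ^ (-k) * s * f ^ k) * t⁻¹ with hw
  have ho := mem_cyclicOrbit o f
  have hinv := zpow_smul_cyclicOrbit o f
  have hk' : 2 * (D + C) + (4 * C + 4) ≤ dist o (f ^ (-k) • o) := by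
    rwa [zpow_neg, dist_smul_inv_self]
  have key : ∀ n : ℕ, n * (2 * dist o (t • o) - 2 * (2 * D + (4 * C + 4))) ≤ dist o (w ^ n • o) ∧
      ProjectsNear (cyclicOrbit o f) o (D + C) ((w ^ n)⁻¹ • o) := by
    intro n
    induction n with
    | zero =>
      refine ⟨by simp, fun p hp => ?_⟩
      -- The coarse projection of `o` is only within `1` of `o`, whence `1 ≤ D`.
      have := hp.2
      simp only [pow_zero, inv_one, one_smul, Metric.infDist_zero_of_mem ho] at this
      rw [dist_comm]
      linarith
    | succ n ih =>
      obtain ⟨ih₁, ih₂⟩ := ih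
      -- One period of `w` is four steps. Those through `s` are only used not to lose length; those
      -- through `t` and `t⁻¹` give the gain.
      obtain ⟨a₁, b₁⟩ := h.step hC hX ho (hinv (-k)) hk' hs ih₂
      obtain ⟨a₂, b₂⟩ := h.step hC hX ho (hinv k) hk ht b₁
      obtain ⟨a₃, b₃⟩ := h.step hC hX ho (hinv (-k)) hk' hs b₂
      obtain ⟨a₄, b₄⟩ := h.step hC hX ho (hinv k) hk ht.inv b₃
      have e : ∀ (g : G) (x y : X), dist (g⁻¹ • x) y = dist x (g • y) := fun g x y => by
        rw [← dist_smul g, smul_inv_smul]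
      have hpow : w ^ n * (f ^ (-k) * s) * (f ^ k * t) * (f ^ (-k) * s) * (f ^ k * t⁻¹) =
          w ^ (n + 1) := by
        rw [pow_succ]
        simp only [hw, mul_assoc]
      simp only [← mul_smul, ← mul_inv_rev, hpow] at a₁ a₂ a₃ a₄ b₄
      simp only [e, ← mul_smul, ← mul_assoc] at a₁ a₂ a₃ a₄
      simp only [← mul_assoc] at hpow
      rw [hpow] at a₄
      rw [dist_smul_inv_self] at a₄
      refine ⟨?_, b₄⟩
      push_cast
      linarith [hs.2.2]
  exact _root_.le_stableLength fun n => (key n).1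

/-! ### Bridges built from arbitrary elements. -/

/-- Three elements such that every point is moved by the inverses of two of them to a point that
projects near `o`. -/
theorem exists_projectsNear_of_ne {o : X} {f₁ f₂ : G} (hX : IsGeodesicSpace X)
    (h₁ : IsContractingElement o f₁) (h₂ : IsContractingElement o f₂)
    (hb : HasBoundedIntersection (cyclicOrbit o f₁) (cyclicOrbit o f₂)) :
    ∃ (D : ℝ) (s : Fin 3 → G), 0 ≤ D ∧ ∀ (x : X) (i j : Fin 3), i ≠ j →
      ProjectsNear (cyclicOrbit o f₂) o D ((s i)⁻¹ • x) ∨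
        ProjectsNear (cyclicOrbit o f₂) o D ((s j)⁻¹ • x) := by
  obtain ⟨hc₁, lam, c, hq⟩ := h₁
  obtain ⟨D, hD, hor⟩ := exists_projectsNear_or hX h₂.1 hc₁ (mem_cyclicOrbit o f₂)
    (mem_cyclicOrbit o f₁) hb
  obtain ⟨N, hN0, hN⟩ := exists_le_dist_zpow hq (2 * D + 1)
  -- If two indices failed, `x` would project along `f₁` within `D` of both `s i • o` and `s j • o`,
  -- which are at least `2D + 1` apart.
  refine ⟨D, fun i => f₁ ^ ((N : ℤ) * ((i : ℕ) : ℤ)), hD, fun x i j hij => ?_⟩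
  by_contra! hcon
  have near : ∀ m : ℤ, ¬ ProjectsNear (cyclicOrbit o f₂) o D ((f₁ ^ m)⁻¹ • x) →
      ∀ p ∈ coarseProj (cyclicOrbit o f₁) x, dist p (f₁ ^ m • o) ≤ D := by
    intro m hm p hp
    have h := (hor _).resolve_right hm ((f₁ ^ m)⁻¹ • p) ?_
    · rwa [← dist_smul (f₁ ^ m), smul_inv_smul] at h
    · rw [← zpow_neg]
      exact smul_mem_coarseProj (zpow_smul_cyclicOrbit o f₁ _) hp
  obtain ⟨p, hp⟩ := coarseProj_nonempty ⟨o, mem_cyclicOrbit o f₁⟩ x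
  have hij' : ((i : ℕ) : ℤ) - ((j : ℕ) : ℤ) ≠ 0 := by
    rw [sub_ne_zero]
    exact_mod_cast Fin.val_ne_of_ne hij
  have hfar := hN ((N : ℤ) * ((i : ℕ) : ℤ)) ((N : ℤ) * ((j : ℕ) : ℤ)) (by
    rw [← mul_sub, abs_mul, Nat.abs_cast]
    exact le_mul_of_one_le_right (by positivity) (Int.one_le_abs hij'))
  linarith [near _ hcon.1 p hp, near _ hcon.2 p hp,
    dist_triangle_left (f₁ ^ ((N : ℤ) * ((i : ℕ) : ℤ)) • o) (f₁ ^ ((N : ℤ) * ((j : ℕ) : ℤ)) • o) p]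

theorem ProjectsNear.of_dist_le {Y : Set X} {C D r : ℝ} {o x y : X} (h : IsContractingWith C Y)
    (hC : 0 ≤ C) (hX : IsGeodesicSpace X) (hY : Y.Nonempty) (hx : ProjectsNear Y o D x)
    (hxy : dist x y ≤ r) : ProjectsNear Y o (D + r + (4 * C + 4)) y := by
  intro q hq
  obtain ⟨p, hp⟩ := coarseProj_nonempty hY x
  linarith [hx p hp, h.dist_proj_le hC hX hY hp hq, dist_triangle_left q o p]

/-- Appending `b`, or `a` for the inverse, moves the endpoint by at most `M`. Coarse Lipschitz
continuity of the projection turns this into the loss `M + (4C + 4)`. -/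
theorem isBridge_inv_mul_mul {Y : Set X} {C D M T : ℝ} {o : X} (h : IsContractingWith C Y)
    (hC : 0 ≤ C) (hX : IsGeodesicSpace X) (hY : Y.Nonempty) {a b g : G}
    (ha : dist o (a • o) ≤ M) (hb : dist o (b • o) ≤ M) (hg : T + 2 * M < dist o (g • o))
    (h₁ : ProjectsNear Y o D (a⁻¹ • g • o)) (h₂ : ProjectsNear Y o D (b⁻¹ • g⁻¹ • o)) :
    IsBridge Y o (D + M + (4 * C + 4)) T (a⁻¹ * g * b) := by
  refine ⟨h₁.of_dist_le h hC hX hY ?_, h₂.of_dist_le h hC hX hY ?_, ?_⟩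
  · rwa [mul_smul, mul_smul, dist_smul, dist_smul]
  · rwa [mul_inv_rev, mul_inv_rev, inv_inv, mul_smul, mul_smul, dist_smul, dist_smul]
  · have h₃ := dist_self_mul_smul_le o (a * (a⁻¹ * g * b)) b⁻¹
    have h₄ := dist_self_mul_smul_le o a (a⁻¹ * g * b)
    rw [dist_smul_inv_self, show a * (a⁻¹ * g * b) * b⁻¹ = g by group] at h₃
    linarith

/-- A normal subgroup with an unbounded orbit contains an element `a` such that, up to a bounded
error, the displacement of each `g` is at most half the stable translation length of `a t a t⁻¹`,
where `t` is obtained from `g` by multiplication with elements of a fixed finite set. -/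
theorem exists_mem_normal_le_stableLength (hX : IsGeodesicSpace X)
    (hc : HasContractingProperty G X) {H : Subgroup G} (hH : H.Normal)
    (hunb : HasUnboundedOrbit X H) :
    ∃ (o : X) (a : G) (s : Fin 3 → G) (B : ℝ), a ∈ H ∧ ∀ g : G, ∃ i j : Fin 3,
      2 * dist o (g • o) - B ≤
        stableLength o (a * ((s i)⁻¹ * g * s j) * a * ((s i)⁻¹ * g * s j)⁻¹) := by
  obtain ⟨o, f₁, f, h₁, h₂, hb⟩ := hc
  obtain ⟨D₀, s, hD₀, hs⟩ := exists_projectsNear_of_ne hX h₁ h₂ hb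
  obtain ⟨⟨C, hC, h⟩, lam, c, hq⟩ := h₂
  obtain ⟨M, hM⟩ : ∃ M, ∀ i, dist o (s i • o) ≤ M := by
    obtain ⟨M, hM⟩ := (Set.finite_range fun i => dist o (s i • o)).bddAbove
    exact ⟨M, fun i => hM ⟨i, rfl⟩⟩
  have hM0 : 0 ≤ M := dist_nonneg.trans (hM 0)
  set D := D₀ + M + (4 * C + 4) with hD
  set T := 2 * D + (4 * C + 4) with hT
  have hY : (cyclicOrbit o f).Nonempty := ⟨o, mem_cyclicOrbit o f⟩
  obtain ⟨N, -, hN⟩ := exists_le_dist_zpow hq (2 * (D + C) + (4 * C + 4))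
  have hk := hN 0 N (by simp)
  rw [zpow_zero, one_smul] at hk
  obtain ⟨h₀, h₀H, hlong⟩ : ∃ h₀ ∈ H, T + 2 * M < dist o (h₀ • o) := by
    by_contra! hcon
    obtain ⟨x, hx⟩ := hunb
    refine hx ((Metric.isBounded_closedBall (x := x) (r := T + 2 * M + 2 * dist x o)).subset ?_)
    rintro _ ⟨g, rfl⟩
    have h3 := (abs_le.1 (abs_dist_sub_dist_le x o (g : G))).2
    rw [Metric.mem_closedBall, dist_comm]
    change dist x ((g : G) • x) ≤ _
    linarith [hcon g g.2]
  -- One index must serve both `h₀` and `h₀⁻¹`, so that the bridge is a conjugate of `h₀` and stays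
  -- in `H`. Each excludes at most one index, so three suffice.
  obtain ⟨i₀, hi₁, hi₂⟩ : ∃ i, ProjectsNear (cyclicOrbit o f) o D₀ ((s i)⁻¹ • h₀ • o) ∧
      ProjectsNear (cyclicOrbit o f) o D₀ ((s i)⁻¹ • h₀⁻¹ • o) := by
    by_contra! hcon
    have p01 := hs (h₀ • o) 0 1 (by decide)
    have p02 := hs (h₀ • o) 0 2 (by decide)
    have p12 := hs (h₀ • o) 1 2 (by decide)
    have q01 := hs (h₀⁻¹ • o) 0 1 (by decide)
    have q02 := hs (h₀⁻¹ • o) 0 2 (by decide)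
    have q12 := hs (h₀⁻¹ • o) 1 2 (by decide)
    have c0 := hcon 0
    have c1 := hcon 1
    have c2 := hcon 2
    tauto
  have hbr := isBridge_inv_mul_mul h hC hX hY (hM i₀) (hM i₀) hlong hi₁ hi₂
  refine ⟨o, f ^ (-(N : ℤ)) * ((s i₀)⁻¹ * h₀ * s i₀) * f ^ (N : ℤ), s, 4 * M + 2 * T, ?_,
    fun g => ?_⟩
  · have h3 := hH.conj_mem h₀ h₀H ((s i₀)⁻¹)
    rw [inv_inv] at h3
    have h4 := hH.conj_mem _ h3 (f ^ (-(N : ℤ)))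
    rwa [zpow_neg, inv_inv, ← zpow_neg] at h4
  · rcases le_or_gt (dist o (g • o)) (T + 2 * M) with hg | hg
    -- For short `g` the constant `4M + 2T` makes the left side nonpositive.
    · exact ⟨0, 0, le_trans (by linarith) (stableLength_nonneg _ _)⟩
    · obtain ⟨i, hi⟩ : ∃ i, ProjectsNear (cyclicOrbit o f) o D₀ ((s i)⁻¹ • g • o) :=
        (hs (g • o) 0 1 (by decide)).elim (fun h => ⟨0, h⟩) fun h => ⟨1, h⟩
      obtain ⟨j, hj⟩ : ∃ j, ProjectsNear (cyclicOrbit o f) o D₀ ((s j)⁻¹ • g⁻¹ • o) :=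
        (hs (g⁻¹ • o) 0 1 (by decide)).elim (fun h => ⟨0, h⟩) fun h => ⟨1, h⟩
      have hbg := isBridge_inv_mul_mul h hC hX hY (hM i) (hM j) hg hi hj
      refine ⟨i, j, le_trans ?_ (h.le_stableLength hC (by linarith) hX hk hbr hbg)⟩
      have h₃ := dist_self_mul_smul_le o (s i * ((s i)⁻¹ * g * s j)) (s j)⁻¹
      have h₄ := dist_self_mul_smul_le o (s i) ((s i)⁻¹ * g * s j)
      rw [dist_smul_inv_self, show s i * ((s i)⁻¹ * g * s j) * (s j)⁻¹ = g by group] at h₃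
      linarith [hM i, hM j]

/-! ### Comparison of two actions. -/

/-- If the stable translation lengths on a normal subgroup with an unbounded orbit do not exceed
those in a second action, then the displacements in `G` do not, up to a bounded error. -/
theorem exists_dist_le_dist_add {X' : Type*} [MetricSpace X'] [MulAction G X']
    [IsIsometricSMul G X'] (hX : IsGeodesicSpace X) (hc : HasContractingProperty G X)
    {H : Subgroup G} (hH : H.Normal) (hunb : HasUnboundedOrbit X H) (o : X) (o' : X')
    (hlen : ∀ g ∈ H, stableLength o g ≤ stableLength o' g) :
    ∃ C : ℝ, ∀ g : G, dist o (g • o) ≤ dist o' (g • o') + C := by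
  obtain ⟨b, a, s, B, ha, hB⟩ := exists_mem_normal_le_stableLength hX hc hH hunb
  obtain ⟨M, hM⟩ : ∃ M, ∀ i, dist o' (s i • o') ≤ M := by
    obtain ⟨M, hM⟩ := (Set.finite_range fun i => dist o' (s i • o')).bddAbove
    exact ⟨M, fun i => hM ⟨i, rfl⟩⟩
  refine ⟨dist o' (a • o') + 2 * M + B / 2 + 2 * dist o b, fun g => ?_⟩
  obtain ⟨i, j, hij⟩ := hB g
  set t := (s i)⁻¹ * g * s j with ht
  -- Only `a` is in `H`; normality handles the conjugate by `t`, so the length hypothesis applies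
  -- although `g` is arbitrary.
  have hmem : a * t * a * t⁻¹ ∈ H := by
    rw [mul_assoc (a * t), mul_assoc a, ← mul_assoc t]
    exact H.mul_mem ha (hH.conj_mem a ha t)
  have h1 := hlen _ hmem
  rw [stableLength_basepoint o b] at h1
  have h2 := stableLength_le o' (a * t * a * t⁻¹)
  have h3 := dist_self_mul_smul_le o' (a * t * a) t⁻¹
  have h4 := dist_self_mul_smul_le o' (a * t) a
  have h5 := dist_self_mul_smul_le o' a t
  have h6 := dist_self_mul_smul_le o' ((s i)⁻¹ * g) (s j)
  have h7 := dist_self_mul_smul_le o' (s i)⁻¹ g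
  rw [dist_smul_inv_self] at h3 h7
  have h8 := (abs_le.1 (abs_dist_sub_dist_le o b g)).2
  linarith [hM i, hM j]

/-- Lets an unbounded orbit in one space serve for the comparison in the other direction. -/
theorem HasUnboundedOrbit.of_dist_le {X' : Type*} [MetricSpace X'] [MulAction G X']
    [IsIsometricSMul G X'] {H : Subgroup G} (h : HasUnboundedOrbit X H) {o : X} {o' : X'} {C : ℝ}
    (hC : ∀ g : G, dist o (g • o) ≤ dist o' (g • o') + C) : HasUnboundedOrbit X' H := by
  obtain ⟨x, hx⟩ := h
  refine ⟨o', fun hb => hx ?_⟩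
  obtain ⟨r, hr⟩ := hb.subset_closedBall o'
  refine (Metric.isBounded_closedBall (x := x) (r := r + C + 2 * dist x o)).subset ?_
  rintro _ ⟨g, rfl⟩
  have h1 : dist ((g : G) • o') o' ≤ r := hr ⟨g, rfl⟩
  have h2 := (abs_le.1 (abs_dist_sub_dist_le x o (g : G))).2
  rw [dist_comm] at h1
  rw [Metric.mem_closedBall, dist_comm]
  change dist x ((g : G) • x) ≤ _
  linarith [hC g]

omit [IsIsometricSMul G X] in
/-- Orbit maps that distort distances by a bounded additive error are rough isometries. -/
theorem IsOrbitMap.isRoughIsometry {X' : Type*} [MetricSpace X'] [MulAction G X'] {o : X}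
    {o' : X'} {C : ℝ} (hC : 0 ≤ C)
    (h : ∀ g k : G, |dist (g • o) (k • o) - dist (g • o') (k • o')| ≤ C)
    {ρ : MulAction.orbit G o → MulAction.orbit G o'} (hρ : IsOrbitMap o o' ρ) :
    IsRoughIsometry ρ := by
  refine ⟨C, hC, ⟨le_rfl, hC, fun x y => ?_⟩, ?_⟩
  · obtain ⟨g, hg, hg'⟩ := hρ x
    obtain ⟨k, hk, hk'⟩ := hρ y
    have h1 := abs_le.1 (h g k)
    rw [Subtype.dist_eq, Subtype.dist_eq, hg, hk, hg', hk']
    constructor <;> linarith [h1.1, h1.2]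
  · choose σ hσ using fun y : MulAction.orbit G o' => y.2
    have hσ' : ∀ y, σ y • o' = y := hσ
    refine ⟨fun y => ⟨σ y • o, σ y, rfl⟩, C, fun x => ?_, fun y => ?_⟩
    · obtain ⟨g, hg, hg'⟩ := hρ x
      have h1 := (abs_le.1 (h g (σ (ρ x)))).2
      rw [hσ', hg', dist_self, sub_zero] at h1
      rwa [Subtype.dist_eq, hg]
    · obtain ⟨g, hg, hg'⟩ := hρ ⟨σ y • o, σ y, rfl⟩
      have h1 := (abs_le.1 (h (σ y) g)).1
      simp only at hg
      rw [hg, dist_self, hσ'] at h1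
      rw [Subtype.dist_eq, hg']
      linarith

end Action

theorem theorem1p5 {G X₁ X₂ : Type*} [Group G]
    [MetricSpace X₁] [MulAction G X₁] [IsIsometricSMul G X₁]
    [MetricSpace X₂] [MulAction G X₂] [IsIsometricSMul G X₂]
    (hX₁ : IsGeodesicSpace X₁) (hX₂ : IsGeodesicSpace X₂)
    (hc₁ : HasContractingProperty G X₁) (hc₂ : HasContractingProperty G X₂)
    (H : Subgroup G) (hH : H.Normal)
    (hunb : HasUnboundedOrbit X₁ H ∨ HasUnboundedOrbit X₂ H)
    (o₁ : X₁) (o₂ : X₂)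
    (hlen : ∀ g ∈ H, stableLength o₁ g = stableLength o₂ g) :
    (∃ C : ℝ, 0 ≤ C ∧ ∀ g h : G,
      |dist (g • o₁) (h • o₁) - dist (g • o₂) (h • o₂)| ≤ C) ∧
    (∃ C : ℝ, ∀ g h : G, g • o₁ = h • o₁ → dist (g • o₂) (h • o₂) ≤ C) ∧
    (∃ ρ : MulAction.orbit G o₁ → MulAction.orbit G o₂, IsOrbitMap o₁ o₂ ρ) ∧
    (∀ ρ : MulAction.orbit G o₁ → MulAction.orbit G o₂,
      IsOrbitMap o₁ o₂ ρ → IsRoughIsometry ρ) ∧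
    (∀ g : G, stableLength o₁ g = stableLength o₂ g) := by
  obtain ⟨C, hC⟩ : ∃ C : ℝ, ∀ g : G, |dist o₁ (g • o₁) - dist o₂ (g • o₂)| ≤ C := by
    have hle : ∀ g ∈ H, stableLength o₁ g ≤ stableLength o₂ g := fun g hg => (hlen g hg).le
    have hge : ∀ g ∈ H, stableLength o₂ g ≤ stableLength o₁ g := fun g hg => (hlen g hg).ge
    obtain ⟨hu₁, hu₂⟩ : HasUnboundedOrbit X₁ H ∧ HasUnboundedOrbit X₂ H := by
      rcases hunb with hu | hu
      · obtain ⟨C, hC⟩ := exists_dist_le_dist_add hX₁ hc₁ hH hu o₁ o₂ hle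
        exact ⟨hu, hu.of_dist_le hC⟩
      · obtain ⟨C, hC⟩ := exists_dist_le_dist_add hX₂ hc₂ hH hu o₂ o₁ hge
        exact ⟨hu.of_dist_le hC, hu⟩
    obtain ⟨A, hA⟩ := exists_dist_le_dist_add hX₁ hc₁ hH hu₁ o₁ o₂ hle
    obtain ⟨B, hB⟩ := exists_dist_le_dist_add hX₂ hc₂ hH hu₂ o₂ o₁ hge
    refine ⟨max A B, fun g => abs_le.2 ⟨?_, ?_⟩⟩
    · linarith [hB g, le_max_right A B]
    · linarith [hA g, le_max_left A B]
  have hC0 : 0 ≤ C := (abs_nonneg _).trans (hC 1)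
  have hdist : ∀ g h : G, |dist (g • o₁) (h • o₁) - dist (g • o₂) (h • o₂)| ≤ C := by
    intro g h
    have := hC (g⁻¹ * h)
    rwa [← dist_smul g o₁, ← dist_smul g o₂, ← mul_smul, ← mul_smul, mul_inv_cancel_left] at this
  refine ⟨⟨C, hC0, hdist⟩, ⟨C, fun g h hgh => ?_⟩, ?_, fun ρ hρ => hρ.isRoughIsometry hC0 hdist,
    stableLength_eq_of_abs_sub_le hC⟩
  · have := (abs_le.1 (hdist g h)).1
    rw [hgh, dist_self] at this
    linarith
  · choose σ hσ using fun x : MulAction.orbit G o₁ => x.2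
    exact ⟨fun x => ⟨σ x • o₂, σ x, rfl⟩, fun x => ⟨σ x, (hσ x).symm, rfl⟩⟩
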